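/- For a total Boolean function $f:\{0,1\}^m\to\{0,1\}$ and $x\in\{0,1\}^m$, let $C(f,x)$ be the least number of coordinates $i$ such that fixing these $x_i$ forces the value of $f$ to be $f(x)$, and let $C(f)=\max_x C(f,x)$ be the certificate complexity of $f$. Let $s(f,x)$ be the number of coordinates $i$ such that flipping $x_i$ changes the value $f(x)$, and let $s(f)=\max_x s(f,x)$ be the sensitivity of $f$. **Corollary (certificate complexity vs. sensitivity).** There is a total Boolean function $f$ with $C(f)\ge\Omega\bigl(s(f)^{3-o(1)}\bigr)$. That is, there are a sequence of total Boolean functions $f_n:\{0,1\}^{m_n}\to\{0,1\}$ $(n\in\mathbb N)$, a sequence of reals $\varepsilon_n\to 0$ and a constant $c>0$ such that $s(f_n)\to\infty$ and $C(f_n)\to\infty$ as $n\to\infty$, and $$C(f_n)\ \ge\ c\cdot s(f_n)^{\,3-\varepsilon_n}\qquad\text{for all } n.$$ -/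

import Mathlib

/-- A partial input: `none` plays the role of the symbol `*`. -/
abbrev PartialInput (n : ℕ) : Type := Fin n → Option Bool

namespace PartialInput

/-- The input `x` agrees with `ρ` in every entry that `ρ` specifies. -/
def Consistent {n : ℕ} (ρ : PartialInput n) (x : Fin n → Bool) : Prop :=
  ∀ i b, ρ i = some b → x i = b

/-- The number of specified entries. -/
def size {n : ℕ} (ρ : PartialInput n) : ℕ :=
  (Finset.univ.filter fun i => ρ i ≠ none).card

end PartialInput

/-- A (total) Boolean function of `n` variables. -/
abbrev BoolFun (n : ℕ) : Type := (Fin n → Bool) → Bool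

namespace BoolFun

/-- `ρ` is a `b`-certificate for `x`: it is consistent with `x`, and `f` takes the value `b` on every
input consistent with `ρ`. -/
def IsCertificate {n : ℕ} (f : BoolFun n) (b : Bool) (x : Fin n → Bool)
    (ρ : PartialInput n) : Prop :=
  ρ.Consistent x ∧ ∀ y, ρ.Consistent y → f y = b

/-- An input with `f x = b` has a `b`-certificate, namely `x` itself, so that the infimum in the next
definition is an attained minimum for every such input. -/
theorem isCertificate_self {n : ℕ} (f : BoolFun n) {b : Bool} {x : Fin n → Bool} (hx : f x = b) :
    f.IsCertificate b x (fun i => some (x i)) := by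
  refine ⟨fun i c h => Option.some.inj h, fun y hy => ?_⟩
  have : y = x := funext fun i => hy i (x i) rfl
  rw [this, hx]

/-- The least size of a `b`-certificate for `x`. -/
noncomputable def certAt {n : ℕ} (f : BoolFun n) (b : Bool) (x : Fin n → Bool) : ℕ :=
  sInf {k : ℕ | ∃ ρ : PartialInput n, f.IsCertificate b x ρ ∧ ρ.size = k}

/-- The maximum of `certAt f b x` over all `x` with `f x = b` (`0` if there is no such `x`). -/
noncomputable def certOn {n : ℕ} (f : BoolFun n) (b : Bool) : ℕ :=
  (Finset.univ.filter fun x => f x = b).sup fun x => f.certAt b x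

/-- The certificate complexity of `f`. -/
noncomputable def certificateComplexity {n : ℕ} (f : BoolFun n) : ℕ :=
  max (f.certOn false) (f.certOn true)

/-- The number of coordinates whose flip changes the value of `f` at `x`. -/
def sensitivityAt {n : ℕ} (f : BoolFun n) (x : Fin n → Bool) : ℕ :=
  (Finset.univ.filter fun i => f (Function.update x i (!x i)) ≠ f x).card

/-- The sensitivity of `f`: the maximum of `sensitivityAt f x` over all inputs `x`. -/
def sensitivity {n : ℕ} (f : BoolFun n) : ℕ :=
  Finset.univ.sup fun x => f.sensitivityAt x

end BoolFun

/-! With `n = 2 ^ t`, a function with sensitivity `n` up to factors polynomial in `t` and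
certificate complexity at least `n ^ 3` is built in three stages. Grid: column subcubes conflict
with row subcubes and have width O(n), yet certifying that the all-false input avoids every column
(or every row) takes `n * n` variables. Cheat sheets: columns may be compatible with one another,
and so may rows. Taking `2 * t` copies, with a column-or-row choice in each, and storing the chosen
lines on a sheet addressed by these choices makes all subcubes conflict pairwise. The width grows
only by a factor polynomial in `t`, and the bound `n * n` survives. Disjunction: an OR of `n` copies
multiplies the certificate bound by `n`. Tripling each variable leaves at most one sensitive
coordinate per copy at a false input, while at a true input sensitivity is at most three times the
width. -/

/-- A partial assignment of truth values to the variables in `V`, viewed as a subcube. -/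
abbrev Subcube (V : Type*) : Type _ := V → Option Bool

namespace Subcube

variable {V : Type*}

/-- The partial assignment `p` agrees with `z` on the variables in `S`. -/
def AgreesOn (p : Subcube V) (z : V → Bool) (S : Set V) : Prop :=
  ∀ v ∈ S, ∀ b, p v = some b → z v = b

/-- The input `z` lies in the subcube `p`. -/
def Contains (p : Subcube V) (z : V → Bool) : Prop :=
  ∀ v b, p v = some b → z v = b

/-- The two subcubes require opposite values of some variable. -/
def Conflicts (p q : Subcube V) : Prop :=
  ∃ v b, p v = some b ∧ q v = some (!b)

/-- The number of fixed variables. -/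
def width [Fintype V] (p : Subcube V) : ℕ :=
  (Finset.univ.filter fun v => p v ≠ none).card

theorem Conflicts.symm {p q : Subcube V} (h : p.Conflicts q) : q.Conflicts p := by
  obtain ⟨v, b, hp, hq⟩ := h
  exact ⟨v, !b, hq, by simpa using hp⟩

/-- The input that follows `p` where `p` is specified and `z` elsewhere. -/
def override (p : Subcube V) (z : V → Bool) : V → Bool := fun v => (p v).getD (z v)

theorem override_eq {p : Subcube V} {z : V → Bool} {v : V} {b : Bool} (h : p v = some b) :
    p.override z v = b := by
  simp [override, h]

theorem AgreesOn.override_eq {p : Subcube V} {z : V → Bool} {S : Set V} (h : p.AgreesOn z S)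
    {v : V} (hv : v ∈ S) : p.override z v = z v := by
  cases hp : p v with
  | none => simp [override, hp]
  | some b => rw [Subcube.override_eq hp, h v hv b hp]

end Subcube

namespace BoolFun

theorem le_certificateComplexity {n : ℕ} (f : BoolFun n) {x : Fin n → Bool} {b : Bool}
    (hx : f x = b) {N : ℕ} (h : ∀ ρ, f.IsCertificate b x ρ → N ≤ ρ.size) :
    N ≤ f.certificateComplexity := by
  have h1 : N ≤ f.certAt b x := by
    refine le_csInf ⟨_, _, isCertificate_self f hx, rfl⟩ ?_
    rintro k ⟨ρ, hρ, rfl⟩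
    exact h ρ hρ
  have h2 : f.certAt b x ≤ f.certOn b :=
    Finset.le_sup (f := fun x => f.certAt b x) (by simp [hx])
  have h3 : f.certOn b ≤ f.certificateComplexity := by
    cases b
    · exact le_max_left _ _
    · exact le_max_right _ _
  exact h1.trans (h2.trans h3)

theorem sensitivityAt_le_sensitivity {n : ℕ} (f : BoolFun n) (x : Fin n → Bool) :
    f.sensitivityAt x ≤ f.sensitivity :=
  Finset.le_sup (f := fun x => f.sensitivityAt x) (Finset.mem_univ x)

/-! ### Disjunction of copies with tripled variables. -/

section OrTriple

variable {V ι : Type*} {m k : ℕ}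

/-- The disjunction of `k` independent copies of the union of the subcubes `p d`, in which every
variable is replaced by three copies that have to take the same value. -/
noncomputable def orTriple (e : V × Fin 3 × Fin k ≃ Fin m) (p : ι → Subcube V) : BoolFun m :=
  open Classical in
  fun y => decide (∃ a d, ∀ v b, p d v = some b → ∀ c, y (e (v, c, a)) = b)

variable (e : V × Fin 3 × Fin k ≃ Fin m) (p : ι → Subcube V)

theorem orTriple_eq_true {y : Fin m → Bool} :
    orTriple e p y = true ↔ ∃ a d, ∀ v b, p d v = some b → ∀ c, y (e (v, c, a)) = b := by
  simp [orTriple]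

theorem orTriple_eq_false {y : Fin m → Bool} :
    orTriple e p y = false ↔ ¬ ∃ a d, ∀ v b, p d v = some b → ∀ c, y (e (v, c, a)) = b := by
  simp [orTriple]

theorem sensitivityAt_orTriple_of_true [Fintype V] {w : ℕ} (hw : ∀ d, (p d).width ≤ w)
    {y : Fin m → Bool} (hy : orTriple e p y = true) :
    (orTriple e p).sensitivityAt y ≤ 3 * w := by
  classical
  obtain ⟨a, d, h⟩ := (orTriple_eq_true e p).1 hy
  have hsub : (Finset.univ.filter fun i =>
      orTriple e p (Function.update y i (!y i)) ≠ orTriple e p y) ⊆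
      ((Finset.univ.filter fun v => p d v ≠ none) ×ˢ (Finset.univ : Finset (Fin 3))).image
        fun q => e (q.1, q.2, a) := by
    intro i hi
    rw [Finset.mem_filter, hy] at hi
    obtain ⟨⟨v, c, a'⟩, rfl⟩ := e.surjective i
    by_contra hcon
    refine hi.2 ((orTriple_eq_true e p).2 ⟨a, d, fun u b hu c' => ?_⟩)
    rw [Function.update_of_ne, h u b hu c']
    intro heq
    have := e.injective heq
    simp only [Prod.mk.injEq] at this
    obtain ⟨rfl, rfl, rfl⟩ := this
    exact hcon (Finset.mem_image.2 ⟨(u, c'), by simp [hu], rfl⟩)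
  calc _ ≤ _ := Finset.card_le_card hsub
    _ ≤ _ := Finset.card_image_le
    _ = (p d).width * 3 := by rw [Finset.card_product]; rfl
    _ ≤ 3 * w := by have := hw d; omega

/-- Each of the `k` blocks has at most one sensitive coordinate: such a coordinate is the only
violation of some subcube in its block, and two of them would contradict either uniqueness or the
conflict of two subcubes. -/
theorem sensitivityAt_orTriple_of_false (hp : ∀ d d', d ≠ d' → (p d).Conflicts (p d'))
    {y : Fin m → Bool} (hy : orTriple e p y = false) :
    (orTriple e p).sensitivityAt y ≤ k := by
  classical
  have hno := (orTriple_eq_false e p).1 hy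
  have key : ∀ v c a, orTriple e p (Function.update y (e (v, c, a)) (!y (e (v, c, a)))) = true →
      ∃ d, (∃ b, p d v = some b ∧ y (e (v, c, a)) ≠ b) ∧ ∀ u b, p d u = some b → ∀ c',
        (u, c') ≠ (v, c) → y (e (u, c', a)) = b := by
    intro v c a h
    obtain ⟨a', d, h⟩ := (orTriple_eq_true e p).1 h
    have hoff : ∀ u b, p d u = some b → ∀ c', (u, c', a') ≠ (v, c, a) →
        y (e (u, c', a')) = b := by
      intro u b hu c' hne
      have := h u b hu c'
      rwa [Function.update_of_ne (fun h => hne (e.injective h))] at this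
    have hex : ∃ u b c', p d u = some b ∧ y (e (u, c', a')) ≠ b := by
      by_contra! hcon
      exact hno ⟨a', d, fun u b hu c' => hcon u b c' hu⟩
    obtain ⟨u, b, c', hu, hne⟩ := hex
    have heq : (u, c', a') = (v, c, a) := by
      by_contra hcon
      exact hne (hoff u b hu c' hcon)
    simp only [Prod.mk.injEq] at heq
    obtain ⟨rfl, rfl, rfl⟩ := heq
    refine ⟨d, ⟨b, hu, hne⟩, fun u' b' hu' c'' hne' => hoff u' b' hu' c'' ?_⟩
    intro h
    simp only [Prod.mk.injEq] at h
    exact hne' (by simp [h])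
  rw [sensitivityAt]
  calc _ ≤ (Finset.univ : Finset (Fin k)).card := by
        refine Finset.card_le_card_of_injOn (fun i => (e.symm i).2.2) (fun _ _ => by simp) ?_
        intro i hi i' hi' heq
        obtain ⟨⟨v, c, a⟩, rfl⟩ := e.surjective i
        obtain ⟨⟨v', c', a'⟩, rfl⟩ := e.surjective i'
        simp only [Equiv.symm_apply_apply] at heq
        subst heq
        simp only [Finset.coe_filter, Finset.mem_univ, true_and, Set.mem_ofPred_eq, hy, ne_eq,
          Bool.not_eq_false] at hi hi'
        obtain ⟨d, ⟨b, hb, hyb⟩, hd⟩ := key v c a hi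
        obtain ⟨d', ⟨b', hb', hyb'⟩, hd'⟩ := key v' c' a hi'
        by_cases hdd : d = d'
        · subst hdd
          by_contra hne
          refine hyb (hd' v b hb c fun h => hne ?_)
          simp only [Prod.mk.injEq] at h
          rw [h.1, h.2]
        · obtain ⟨u, β, hu, hu'⟩ := hp d d' hdd
          -- Two flips touch at most two of the three copies of `u`; the remaining copy would need
          -- both values.
          obtain ⟨c₀, h1, h2⟩ : ∃ c₀ : Fin 3, c₀ ≠ c ∧ c₀ ≠ c' := by
            clear * -
            revert c c'
            decide
          have e1 := hd u β hu c₀ (by simp [h1])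
          have e2 := hd' u _ hu' c₀ (by simp [h2])
          rw [e1] at e2
          simp at e2
    _ = k := by simp

theorem sensitivity_orTriple_le [Fintype V] {w : ℕ} (hw : ∀ d, (p d).width ≤ w)
    (hp : ∀ d d', d ≠ d' → (p d).Conflicts (p d')) :
    (orTriple e p).sensitivity ≤ max k (3 * w) := by
  refine Finset.sup_le fun y _ => ?_
  cases hy : orTriple e p y
  · exact (sensitivityAt_orTriple_of_false e p hp hy).trans (le_max_left _ _)
  · exact (sensitivityAt_orTriple_of_true e p hw hy).trans (le_max_right _ _)

/-- This makes the sensitivity tend to infinity. The input follows `p d` in every block except in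
copy `0` of `v`, so that repairing any one block makes the value true. -/
theorem le_sensitivity_orTriple (hp : ∀ d d', d ≠ d' → (p d).Conflicts (p d')) {d : ι} {v : V}
    (hv : p d v ≠ none) : k ≤ (orTriple e p).sensitivity := by
  classical
  obtain ⟨b, hb⟩ := Option.ne_none_iff_exists'.1 hv
  let y : Fin m → Bool := fun i =>
    if (e.symm i).1 = v ∧ (e.symm i).2.1 = 0 then !b
    else (p d).override (fun _ => false) (e.symm i).1
  have hy1 : ∀ a, y (e (v, 0, a)) = !b := fun a => by simp [y]
  have hy2 : ∀ u β, p d u = some β → ∀ c a, ¬ (u = v ∧ c = 0) → y (e (u, c, a)) = β := by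
    intro u β hu c a hne
    simp [y, hne, Subcube.override_eq hu]
  have hy : orTriple e p y = false := by
    rw [orTriple_eq_false]
    rintro ⟨a, d', h⟩
    by_cases hd : d = d'
    · subst hd
      have := h v b hb 0
      rw [hy1] at this
      simp at this
    · obtain ⟨u, β, hu, hu'⟩ := hp d d' hd
      have e1 := hy2 u β hu 1 a (by simp)
      have e2 := h u _ hu' 1
      rw [e1] at e2
      simp at e2
  refine le_trans ?_ (sensitivityAt_le_sensitivity _ y)
  rw [sensitivityAt]
  calc k = ((Finset.univ : Finset (Fin k)).image fun a => e (v, 0, a)).card := by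
        rw [Finset.card_image_of_injective]
        · simp
        · intro a a' h
          simpa using e.injective h
    _ ≤ _ := by
        refine Finset.card_le_card fun i hi => ?_
        obtain ⟨a, -, rfl⟩ := Finset.mem_image.1 hi
        rw [Finset.mem_filter, hy]
        refine ⟨Finset.mem_univ _, ?_⟩
        rw [ne_eq, Bool.not_eq_false, orTriple_eq_true]
        refine ⟨a, d, fun u β hu c => ?_⟩
        by_cases hc : u = v ∧ c = 0
        · obtain ⟨rfl, rfl⟩ := hc
          rw [Function.update_self, hy1, Bool.not_not]
          exact Option.some.inj (hb.symm.trans hu)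
        · rw [Function.update_of_ne, hy2 u β hu c a hc]
          intro h
          have := e.injective h
          simp only [Prod.mk.injEq] at this
          exact hc ⟨this.1, this.2.1⟩

theorem le_certificateComplexity_orTriple [Fintype V] {z : V → Bool} {r : ℕ}
    (hz : ∀ d, ¬ (p d).Contains z)
    (hr : ∀ S : Finset V, S.card < r → ∃ d, (p d).AgreesOn z S) :
    k * r ≤ (orTriple e p).certificateComplexity := by
  classical
  let y : Fin m → Bool := fun i => z (e.symm i).1
  have hy : orTriple e p y = false := by
    rw [orTriple_eq_false]
    rintro ⟨a, d, h⟩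
    exact hz d fun v b hv => by simpa [y] using h v b hv 0
  refine le_certificateComplexity _ hy fun ρ hρ => ?_
  -- If `ρ` meets fewer than `r` variables of block `a`, that block can be moved into some `p d`
  -- without contradicting `ρ`.
  let S : Fin k → Finset V := fun a => Finset.univ.filter fun v => ∃ c, ρ (e (v, c, a)) ≠ none
  have hS : ∀ a, r ≤ (S a).card := by
    intro a
    by_contra! hlt
    obtain ⟨d, hd⟩ := hr (S a) hlt
    let y' : Fin m → Bool := fun i =>
      if (e.symm i).2.2 = a then (p d).override z (e.symm i).1 else y i
    have hcons : ρ.Consistent y' := by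
      intro i b hi
      rw [← hρ.1 i b hi]
      obtain ⟨⟨v, c, a'⟩, rfl⟩ := e.surjective i
      by_cases ha : a' = a
      · subst ha
        have hv : v ∈ (S a' : Set V) := by
          simp only [S, Finset.coe_filter, Finset.mem_univ, true_and, Set.mem_ofPred_eq]
          exact ⟨c, by simp [hi]⟩
        simp [y', y, hd.override_eq hv]
      · simp [y', ha]
    have h1 := hρ.2 y' hcons
    have h2 : orTriple e p y' = true :=
      (orTriple_eq_true e p).2 ⟨a, d, fun v b hv c => by simp [y', Subcube.override_eq hv]⟩
    rw [h1] at h2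
    simp at h2
  have hc : ∀ a v, ∃ c, v ∈ S a → ρ (e (v, c, a)) ≠ none := by
    intro a v
    by_cases h : v ∈ S a
    · obtain ⟨c, hc⟩ := (Finset.mem_filter.1 h).2
      exact ⟨c, fun _ => hc⟩
    · exact ⟨0, fun h' => absurd h' h⟩
  choose c hc using hc
  calc k * r = ∑ _a : Fin k, r := by simp
    _ ≤ ∑ a : Fin k, (S a).card := Finset.sum_le_sum fun a _ => hS a
    _ = (Finset.univ.sigma S).card := (Finset.card_sigma _ _).symm
    _ ≤ ρ.size := by
        refine Finset.card_le_card_of_injOn (fun q => e (q.2, c q.1 q.2, q.1)) ?_ ?_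
        · rintro ⟨a, v⟩ h
          have h : v ∈ S a := by simpa using h
          simpa using hc a v h
        · rintro ⟨a, v⟩ - ⟨a', v'⟩ - h
          have := e.injective h
          simp only [Prod.mk.injEq] at this
          obtain ⟨rfl, -, rfl⟩ := this
          rfl

end OrTriple

/-- A family of pairwise conflicting subcubes of width at most `w`, such that no set of fewer than
`r` variables certifies that `z` avoids all of them, yields a Boolean function of sensitivity at
most `max k (3 * w)` and certificate complexity at least `k * r`. -/
theorem exists_of_subcubes {V ι : Type*} [Fintype V] (p : ι → Subcube V) {w r : ℕ}
    (z : V → Bool) (hw : ∀ d, (p d).width ≤ w) (hp : ∀ d d', d ≠ d' → (p d).Conflicts (p d'))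
    (hz : ∀ d, ¬ (p d).Contains z) (hr : ∀ S : Finset V, S.card < r → ∃ d, (p d).AgreesOn z S)
    (hr0 : 0 < r) (k : ℕ) :
    ∃ (m : ℕ) (f : BoolFun m), k ≤ f.sensitivity ∧ f.sensitivity ≤ max k (3 * w) ∧
      k * r ≤ f.certificateComplexity := by
  let e := Fintype.equivFin (V × Fin 3 × Fin k)
  obtain ⟨d, -⟩ := hr ∅ (by simpa using hr0)
  obtain ⟨v, hv⟩ : ∃ v, p d v ≠ none := by
    by_contra! h
    exact hz d fun v b hv => by simp [h v] at hv
  exact ⟨_, orTriple e p, le_sensitivity_orTriple e p hp hv, sensitivity_orTriple_le e p hw hp,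
    le_certificateComplexity_orTriple e p hz hr⟩

end BoolFun

namespace Subcube

/-! ### Cheat sheets: making all subcubes conflict. -/

section CheatSheet

variable {X D K W : Type*}

/-- The subcube that follows `p (s i) (d i)` on the `i`-th copy of the variables `X`, for every
`i : K`, and stores the code of `d` on the sheet with address `s`. -/
noncomputable def cheatSheet (p : Bool → D → Subcube X) (enc : (K → D) → W → Bool)
    (q : (K → Bool) × (K → D)) : Subcube ((K × X) ⊕ ((K → Bool) × W)) :=
  Sum.elim (fun u => p (q.1 u.1) (q.2 u.1) u.2)
    (open Classical in fun u => if u.1 = q.1 then some (enc q.2 u.2) else none)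

variable (p : Bool → D → Subcube X) (enc : (K → D) → W → Bool)

/-- Different addresses conflict in a copy where the types differ; equal addresses share a sheet, on
which different codes conflict. -/
theorem cheatSheet_conflicts (hp : ∀ d d', (p true d).Conflicts (p false d'))
    (henc : Function.Injective enc) (q q' : (K → Bool) × (K → D)) (hq : q ≠ q') :
    (cheatSheet p enc q).Conflicts (cheatSheet p enc q') := by
  obtain ⟨s, d⟩ := q
  obtain ⟨s', d'⟩ := q'
  by_cases hs : s = s'
  · subst hs
    have hd : enc d ≠ enc d' := fun h => hq (by rw [henc h])
    obtain ⟨w, hw⟩ := Function.ne_iff.1 hd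
    refine ⟨Sum.inr (s, w), enc d w, by simp [cheatSheet], ?_⟩
    simpa [cheatSheet] using Bool.eq_not.2 hw.symm
  · obtain ⟨i, hi⟩ := Function.ne_iff.1 hs
    have : (p (s i) (d i)).Conflicts (p (s' i) (d' i)) := by
      cases h : s i <;> cases h' : s' i
      · exact absurd (h.trans h'.symm) hi
      · exact (hp _ _).symm
      · exact hp _ _
      · exact absurd (h.trans h'.symm) hi
    obtain ⟨x, b, h1, h2⟩ := this
    exact ⟨Sum.inl (i, x), b, by simpa [cheatSheet] using h1, by simpa [cheatSheet] using h2⟩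

theorem not_contains_cheatSheet [Nonempty K] {x : X → Bool}
    (hx : ∀ b d, ¬ (p b d).Contains x) (q : (K → Bool) × (K → D)) (z : (K → Bool) × W → Bool) :
    ¬ (cheatSheet p enc q).Contains (Sum.elim (fun u => x u.2) z) := by
  intro h
  obtain ⟨i⟩ := ‹Nonempty K›
  exact hx (q.1 i) (q.2 i) fun v b hv => by
    simpa using h (Sum.inl (i, v)) b (by simpa [cheatSheet] using hv)

theorem width_cheatSheet_le [Fintype K] [DecidableEq K] [Fintype X] [Fintype W] {w : ℕ}
    (hw : ∀ b d, (p b d).width ≤ w) (q : (K → Bool) × (K → D)) :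
    (cheatSheet p enc q).width ≤ Fintype.card K * w + Fintype.card W := by
  classical
  have hsub : (Finset.univ.filter fun v => cheatSheet p enc q v ≠ none) ⊆
      ((Finset.univ : Finset K).biUnion fun i =>
        (Finset.univ.filter fun x => p (q.1 i) (q.2 i) x ≠ none).image fun x => Sum.inl (i, x)) ∪
      (Finset.univ : Finset W).image fun u => Sum.inr (q.1, u) := by
    rintro (⟨i, x⟩ | ⟨s, u⟩) h
    · simpa [cheatSheet] using (Finset.mem_filter.1 h).2
    · have : s = q.1 := by simpa [cheatSheet] using (Finset.mem_filter.1 h).2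
      simp [this]
  refine (Finset.card_le_card hsub).trans ((Finset.card_union_le _ _).trans ?_)
  refine add_le_add ?_ Finset.card_image_le
  refine Finset.card_biUnion_le_card_mul _ _ _ fun i _ => ?_
  exact Finset.card_image_le.trans (hw _ _)

/-- There are at least `r` sheets, so `S` misses one entirely. Its address fixes the types, and in
each copy `S` is too small to exclude a subcube of that type. -/
theorem exists_cheatSheet_agreesOn [Fintype K] {x : X → Bool} {r : ℕ}
    (hrK : r ≤ 2 ^ Fintype.card K)
    (hr : ∀ S : Finset X, S.card < r → ∀ b, ∃ d, (p b d).AgreesOn x S)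
    (z : (K → Bool) × W → Bool) (S : Finset ((K × X) ⊕ ((K → Bool) × W))) (hS : S.card < r) :
    ∃ q, (cheatSheet p enc q).AgreesOn (Sum.elim (fun u => x u.2) z) S := by
  classical
  obtain ⟨s, hs⟩ : ∃ s : K → Bool, ∀ w, Sum.inr (s, w) ∉ S := by
    by_contra! hcon
    choose w hw using hcon
    have : Fintype.card (K → Bool) ≤ S.card := by
      rw [← Finset.card_univ]
      refine Finset.card_le_card_of_injOn (fun s => Sum.inr (s, w s)) (fun s _ => hw s) ?_
      intro s _ s' _ h
      simpa using congrArg (Sum.elim (fun _ => s) Prod.fst) h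
    simp at this
    omega
  have hd : ∀ i, ∃ d, (p (s i) d).AgreesOn x {v | Sum.inl (i, v) ∈ S} := by
    intro i
    have hinj : Set.InjOn (fun v : X => (Sum.inl (i, v) : (K × X) ⊕ ((K → Bool) × W)))
        ((fun v : X => (Sum.inl (i, v) : (K × X) ⊕ ((K → Bool) × W))) ⁻¹' (S : Set _)) := by
      intro v _ v' _ h
      simpa using h
    obtain ⟨d, hd⟩ := hr (S.preimage _ hinj)
      ((Finset.card_le_card_of_injOn _ (fun v hv => by simpa using hv)
        (by simp)).trans_lt hS) (s i)
    exact ⟨d, fun v hv => hd v (by simpa using hv)⟩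
  choose d hd using hd
  refine ⟨(s, d), ?_⟩
  rintro (⟨i, v⟩ | ⟨s', w⟩) hv b hb
  · exact hd i v hv b hb
  · by_cases h : s' = s
    · subst h
      exact absurd hv (hs w)
    · simp [cheatSheet, h] at hb

end CheatSheet

/-! ### Rows and columns of a grid of bit strings. -/

section Grid

/-- A line of the `n × n` grid with a level for each of its cells, of total at most `n`. -/
abbrev LevelledLine (n : ℕ) : Type :=
  {q : Fin n × (Fin n → Fin n) // ∑ i, (q.2 i : ℕ) ≤ n}

/-- Every cell of the `n × n` grid holds a string of `2 * n` bits. The subcube `grid b d` requires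
the first `true` of each cell of the column (`b = true`) or row (`b = false`) given by `d` to be at
the position of parity `b` that is given by the level of the cell. -/
def grid {n : ℕ} (b : Bool) (d : LevelledLine n) : Subcube (Fin n × Fin n × Fin (2 * n)) :=
  fun v =>
    if (if b then v.2.1 else v.1) = d.1.1 then
      if (v.2.2 : ℕ) < 2 * d.1.2 (if b then v.1 else v.2.1) + b.toNat then some false
      else if (v.2.2 : ℕ) = 2 * d.1.2 (if b then v.1 else v.2.1) + b.toNat then some true
      else none
    else none

variable {n : ℕ}

/-- In the common cell the first `true` would be at both an odd and an even position; the conflict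
sits at the smaller of the two. -/
theorem grid_conflicts (d d' : LevelledLine n) : (grid true d).Conflicts (grid false d') := by
  have h1 := (d.1.2 d'.1.1).2
  have h2 := (d'.1.2 d.1.1).2
  rcases lt_or_ge (2 * (d.1.2 d'.1.1 : ℕ) + 1) (2 * (d'.1.2 d.1.1 : ℕ)) with h | h
  · refine ⟨(d'.1.1, d.1.1, ⟨2 * d.1.2 d'.1.1 + 1, by omega⟩), true, ?_, ?_⟩
    · simp [grid]
    · simp [grid, h]
  · refine ⟨(d'.1.1, d.1.1, ⟨2 * d'.1.2 d.1.1, by omega⟩), false, ?_, ?_⟩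
    · have : 2 * (d'.1.2 d.1.1 : ℕ) < 2 * (d.1.2 d'.1.1 : ℕ) + 1 := by omega
      simp [grid, this]
    · simp [grid]

theorem not_contains_grid [NeZero n] (b : Bool) (d : LevelledLine n) :
    ¬ (grid b d).Contains fun _ => false := by
  intro h
  have h0 := (d.1.2 0).2
  cases b
  · simpa using h (d.1.1, 0, ⟨2 * d.1.2 0, by omega⟩) true (by simp [grid])
  · simpa using h (0, d.1.1, ⟨2 * d.1.2 0 + 1, by omega⟩) true (by simp [grid])

/-- A cell of level `l` fixes at most `2 * l + 2` bits, and the levels sum to at most `n`. -/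
theorem width_grid_le (b : Bool) (d : LevelledLine n) : (grid b d).width ≤ 4 * n := by
  classical
  have hle : (grid b d).width ≤
      (Finset.univ.sigma fun i => Finset.range (2 * (d.1.2 i : ℕ) + 2)).card := by
    refine Finset.card_le_card_of_injOn
      (fun v => ⟨if b then v.1 else v.2.1, (v.2.2 : ℕ)⟩) ?_ ?_
    · rintro ⟨i, j, l⟩ h
      cases b <;> simp [grid] at h ⊢ <;> grind
    · rintro ⟨i, j, l⟩ h ⟨i', j', l'⟩ h' heq
      cases b <;> simp [grid] at h h' heq ⊢ <;> grind
  refine hle.trans ?_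
  rw [Finset.card_sigma]
  simp only [Finset.card_range, Finset.sum_add_distrib, ← Finset.mul_sum]
  have := d.2
  simp
  omega

theorem exists_grid_agreesOn (S : Finset (Fin n × Fin n × Fin (2 * n))) (hS : S.card < n * n)
    (b : Bool) : ∃ d : LevelledLine n, (grid b d).AgreesOn (fun _ => false) S := by
  classical
  let line : Fin n × Fin n × Fin (2 * n) → Fin n := fun v => if b then v.2.1 else v.1
  let cell : Fin n × Fin n × Fin (2 * n) → Fin n := fun v => if b then v.1 else v.2.1
  -- Some line meets `S` in fewer than `n` variables.
  obtain ⟨j, -, hj⟩ := Finset.exists_lt_of_sum_lt (s := (Finset.univ : Finset (Fin n)))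
    (f := fun j => (S.filter fun v => line v = j).card) (g := fun _ => n) (by
      rw [← Finset.card_eq_sum_card_fiberwise (fun v _ => by simp)]
      simpa using hS)
  let T : Fin n → Finset (Fin n × Fin n × Fin (2 * n)) := fun i =>
    (S.filter fun v => line v = j).filter fun v => cell v = i
  have hT : ∑ i, (T i).card = (S.filter fun v => line v = j).card :=
    (Finset.card_eq_sum_card_fiberwise (fun v _ => by simp)).symm
  -- Among the `(T i).card + 1` lowest levels, one has its `true` position outside `S`. Summing over
  -- cells keeps the total level below `n`.
  have hlev : ∀ i, ∃ l, l ≤ (T i).card ∧ ∀ v ∈ T i, (v.2.2 : ℕ) ≠ 2 * l + b.toNat := by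
    intro i
    by_contra! hcon
    have hcon' : ∀ l : Fin ((T i).card + 1), ∃ v ∈ T i, (v.2.2 : ℕ) = 2 * l + b.toNat :=
      fun l => hcon l (Nat.lt_succ_iff.1 l.2)
    choose g hg hgl using hcon'
    have := Finset.card_le_card_of_injOn (s := Finset.univ) g (fun l _ => hg l) (by
      intro l _ l' _ h
      have h1 := hgl l
      rw [h, hgl l'] at h1
      exact Fin.ext (by omega))
    simp at this
  choose l hl hlS using hlev
  have hle : ∀ i, (T i).card ≤ ∑ i, (T i).card := fun i =>
    Finset.single_le_sum (f := fun i => (T i).card) (fun _ _ => Nat.zero_le _) (Finset.mem_univ i)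
  have hlt : ∀ i, l i < n := fun i => ((hl i).trans (hle i)).trans_lt (hT ▸ hj)
  refine ⟨⟨(j, fun i => ⟨l i, hlt i⟩), ?_⟩, ?_⟩
  · exact (Finset.sum_le_sum fun i _ => hl i).trans (hT ▸ hj.le)
  · intro v hv β hβ
    cases β
    · rfl
    · exfalso
      simp only [grid] at hβ
      change (if line v = j then if (v.2.2 : ℕ) < 2 * l (cell v) + b.toNat then some false
        else if (v.2.2 : ℕ) = 2 * l (cell v) + b.toNat then some true else none else none) =
          some true at hβ
      split_ifs at hβ with h1 h2 h3 <;> simp at hβ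
      exact hlS (cell v) v (by simp [T, h1, Finset.mem_coe.1 hv]) h3

end Grid

end Subcube

/-! ### Choice of parameters and asymptotics. -/

theorem card_levelledLine_le (t : ℕ) :
    Fintype.card (Subcube.LevelledLine (2 ^ t)) ≤ 2 ^ (t * (2 ^ t + 1)) := by
  refine (Fintype.card_subtype_le _).trans ?_
  simp only [Fintype.card_prod, Fintype.card_fun, Fintype.card_fin]
  rw [← pow_mul, ← pow_add]
  exact Nat.pow_le_pow_right (by norm_num) (by ring_nf; rfl)

/-- For every `t ≥ 1` there is a Boolean function of sensitivity between `2 ^ t` and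
`36 * t ^ 2 * 2 ^ t` whose certificate complexity is at least `2 ^ (3 * t)`. -/
theorem BoolFun.exists_low_sensitivity (t : ℕ) (ht : 1 ≤ t) :
    ∃ (m : ℕ) (f : BoolFun m), 2 ^ t ≤ f.sensitivity ∧ f.sensitivity ≤ 36 * t ^ 2 * 2 ^ t ∧
      2 ^ (3 * t) ≤ f.certificateComplexity := by
  classical
  have hne : Nonempty (Fin (2 * t)) := ⟨⟨0, by omega⟩⟩
  -- A levelled line takes `t * (2 ^ t + 1)` bits to encode, and there are `2 * t` of them, which
  -- gives `2 ^ (2 * t)` sheets, the number that `r` requires.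
  have hcard : Fintype.card (Fin (2 * t) → Subcube.LevelledLine (2 ^ t)) ≤
      Fintype.card (Fin (t * (2 ^ t + 1) * (2 * t)) → Bool) := by
    simp only [Fintype.card_fun, Fintype.card_fin, Fintype.card_bool]
    rw [pow_mul 2 (t * (2 ^ t + 1))]
    exact Nat.pow_le_pow_left (card_levelledLine_le t) _
  obtain ⟨enc⟩ := Function.Embedding.nonempty_of_card_le hcard
  obtain ⟨m, f, h1, h2, h3⟩ := BoolFun.exists_of_subcubes
    (Subcube.cheatSheet Subcube.grid enc) (r := 2 ^ t * 2 ^ t)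
    (Sum.elim (fun _ => false) fun _ => false)
    (Subcube.width_cheatSheet_le _ _ Subcube.width_grid_le)
    (Subcube.cheatSheet_conflicts _ _ Subcube.grid_conflicts enc.injective)
    (fun q => Subcube.not_contains_cheatSheet _ _ Subcube.not_contains_grid q _)
    (Subcube.exists_cheatSheet_agreesOn _ _
      (by rw [Fintype.card_fin, ← pow_add, two_mul]) Subcube.exists_grid_agreesOn _)
    (by positivity) (2 ^ t)
  refine ⟨m, f, h1, h2.trans (max_le ?_ ?_), le_trans (le_of_eq (by ring)) h3⟩
  · exact Nat.le_mul_of_pos_left _ (by positivity)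
  -- Three times the width is at most `24 * t * n + 6 * t ^ 2 * (n + 1)`, whence the constant `36 =
  -- 24 + 6 + 6`.
  · simp only [Fintype.card_fin]
    have hn : 1 ≤ 2 ^ t := Nat.one_le_two_pow
    generalize 2 ^ t = n at hn
    have a1 : t * n ≤ t ^ 2 * n := Nat.mul_le_mul_right n (by nlinarith)
    have a2 : t ^ 2 ≤ t ^ 2 * n := Nat.le_mul_of_pos_right _ hn
    nlinarith

theorem Real.rpow_three_sub_le {s p x : ℝ} (hs : 1 ≤ s) (hp : 1 ≤ p) (hx : 1 < x)
    (hsx : s ≤ p * x) : s ^ (3 - 3 * Real.log p / Real.log x) ≤ x ^ 3 := by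
  have hs0 : 0 < s := by linarith
  have hx0 : 0 < x := by linarith
  have hp0 : 0 < p := by linarith
  have hlx : 0 < Real.log x := Real.log_pos hx
  have hlp : 0 ≤ Real.log p := Real.log_nonneg hp
  have hls : 0 ≤ Real.log s := Real.log_nonneg hs
  have hle : Real.log s ≤ Real.log p + Real.log x := by
    rw [← Real.log_mul hp0.ne' hx0.ne']
    exact Real.log_le_log hs0 hsx
  rw [← Real.log_le_log_iff (by positivity) (by positivity), Real.log_rpow hs0, Real.log_pow]
  rw [← sub_nonneg]
  have : (3 : ℕ) * Real.log x - (3 - 3 * Real.log p / Real.log x) * Real.log s =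
      3 * ((Real.log x) ^ 2 - (Real.log x - Real.log p) * Real.log s) / Real.log x := by
    field_simp
    push_cast
    ring
  rw [this]
  refine div_nonneg (mul_nonneg (by norm_num) ?_) hlx.le
  -- If `log x ≤ log p`, the subtracted product is nonpositive; otherwise it is at most `(log x) ^ 2
  -- - (log p) ^ 2`.
  rcases le_total (Real.log x) (Real.log p) with h | h
  · nlinarith [mul_nonneg (sub_nonneg.2 h) hls]
  · nlinarith [mul_le_mul_of_nonneg_left hle (sub_nonneg.2 h), sq_nonneg (Real.log p)]

theorem tendsto_log_sq_div_log_two_pow :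
    Filter.Tendsto (fun n : ℕ => 3 * Real.log (36 * ((n + 1 : ℕ) : ℝ) ^ 2) /
      Real.log (2 ^ (n + 1))) Filter.atTop (nhds 0) := by
  have h0 : Filter.Tendsto (fun x : ℝ => Real.log x / x) Filter.atTop (nhds 0) := by
    simpa using Real.isLittleO_log_id_atTop.tendsto_div_nhds_zero
  have hc : Filter.Tendsto (fun n : ℕ => ((n + 1 : ℕ) : ℝ)) Filter.atTop Filter.atTop :=
    tendsto_natCast_atTop_atTop.comp (Filter.tendsto_add_atTop_nat 1)
  have h1 := h0.comp hc
  have h2 := (tendsto_inv_atTop_zero (𝕜 := ℝ)).comp hc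
  have h := (h2.const_mul (3 * Real.log 36 / Real.log 2)).add (h1.const_mul (6 / Real.log 2))
  simp only [mul_zero, add_zero] at h
  refine h.congr fun n => ?_
  have hn : ((n + 1 : ℕ) : ℝ) ≠ 0 := by positivity
  have hl : Real.log 2 ≠ 0 := (Real.log_pos one_lt_two).ne'
  simp only [Function.comp]
  rw [Real.log_mul (by norm_num) (by positivity), Real.log_pow, Real.log_pow]
  field_simp
  push_cast
  ring

theorem mainTheorem6 :
    ∃ (m : ℕ → ℕ) (f : (n : ℕ) → BoolFun (m n)) (ε : ℕ → ℝ) (c : ℝ),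
      0 < c ∧
      Filter.Tendsto ε Filter.atTop (nhds 0) ∧
      Filter.Tendsto (fun n => (f n).sensitivity) Filter.atTop Filter.atTop ∧
      Filter.Tendsto (fun n => (f n).certificateComplexity) Filter.atTop Filter.atTop ∧
      ∀ n, c * ((f n).sensitivity : ℝ) ^ (3 - ε n) ≤ ((f n).certificateComplexity : ℝ) := by
  choose m f h1 h2 h3 using fun n : ℕ => BoolFun.exists_low_sensitivity (n + 1) (by omega)
  refine ⟨m, f, _, 1, one_pos, tendsto_log_sq_div_log_two_pow, ?_, ?_, fun n => ?_⟩
  · refine Filter.tendsto_atTop_mono (fun n => ?_) Filter.tendsto_id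
    exact ((Nat.lt_succ_self n).le.trans Nat.lt_two_pow_self.le).trans (h1 n)
  · refine Filter.tendsto_atTop_mono (fun n => ?_) Filter.tendsto_id
    refine le_trans ?_ (h3 n)
    exact (show n ≤ 3 * (n + 1) by omega).trans Nat.lt_two_pow_self.le
  · rw [one_mul]
    have hs : (1 : ℝ) ≤ (f n).sensitivity := by
      exact_mod_cast Nat.one_le_two_pow.trans (h1 n)
    have ht : (1 : ℝ) ≤ ((n + 1 : ℕ) : ℝ) := by exact_mod_cast Nat.le_add_left 1 n
    refine (Real.rpow_three_sub_le hs (by nlinarith) (one_lt_pow₀ one_lt_two (by omega))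
      (by exact_mod_cast h2 n)).trans ?_
    rw [← pow_mul, mul_comm]
    exact_mod_cast h3 n
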